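/- Let $k$ be an algebraically closed field and let $G$ be an affine group scheme over $k$, written as an inverse limit $G = \varprojlim_{i \in I} G_i$, in the category of group schemes over $k$, of an inverse system of algebraic groups $G_i$ (affine group schemes of finite type over $k$, not necessarily reduced) with homomorphisms as transition maps, indexed by a non-empty directed poset $I$. Assume that one of the following conditions holds: i) $I$ is (at most) countable; ii) the cardinality of $I$ is strictly less than the cardinality of $k$. Let $P$ be a $G$-torsor over $k$, i.e. a non-empty affine scheme over $k$ with a (left) $G$-action such that the morphism $G \times_k P \to P \times_k P$, $(g,p) \mapsto (gp,p)$, is an isomorphism. Then $P$ is trivial, i.e. $P(k) \neq \emptyset$. -/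

import Mathlib

open CategoryTheory Limits AlgebraicGeometry MonoidalCategory CartesianMonoidalCategory

universe u w

/-- Schemes over the field `k`. -/
abbrev SchemeOver (k : Type u) [Field k] : Type (u + 1) :=
  Over (Spec (CommRingCat.of k))

/-- Group schemes over the field `k`; morphisms are homomorphisms of group schemes over `k`. -/
abbrev GroupSchemeOver (k : Type u) [Field k] : Type (u + 1) :=
  Grp (SchemeOver k)

/-- The group scheme `G` over `k` is affine. -/
def IsAffineGroupScheme {k : Type u} [Field k] (G : GroupSchemeOver k) : Prop :=
  IsAffine G.X.left

/-- The group scheme `G` over `k` is an (affine) algebraic group: it is affine and of finite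
type over `k`. It need not be reduced. -/
structure IsAlgebraicGroup {k : Type u} [Field k] (G : GroupSchemeOver k) : Prop where
  isAffine : IsAffineGroupScheme G
  locallyOfFiniteType : LocallyOfFiniteType G.X.hom

/-- Let the group scheme `G` over `k` act on the `k`-scheme `P` (from the left). Then `P` is a
`G`-torsor if it is a non-empty affine scheme and the morphism
`G ×ₖ P ⟶ P ×ₖ P`, `(g, p) ↦ (g p, p)` is an isomorphism. -/
structure IsAffineTorsor {k : Type u} [Field k] (G : GroupSchemeOver k) (P : SchemeOver k)
    [ModObj G.X P] : Prop where
  isAffine : IsAffine P.left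
  nonempty : Nonempty P.left
  isIso : IsIso (lift (ModObj.smul (M := G.X) (X := P) : G.X ⊗ P ⟶ P) (snd G.X P))

/-- The set `P(k)` of `k`-rational points of a `k`-scheme `P`: the sections over `k` of the
structure morphism `P ⟶ Spec k`. -/
def RationalPoints {k : Type u} [Field k] (P : SchemeOver k) : Type u :=
  Over.mk (𝟙 (Spec (CommRingCat.of k))) ⟶ P

/-!
The torsor `P` becomes isomorphic to `G` over any field `K` over which it has a point, for instance
the residue field of a closed point of `P` (`IsAffineTorsor.nonempty_algEquiv`). Write `A` and `B`
for the coordinate rings of `G` and `P`. Then `K ⊗ A ≃ K ⊗ B` as `K`-algebras, and what is needed is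
a `k`-algebra homomorphism `B → k`. Since `A` is the directed colimit of the coordinate rings of
the `G i`, the dimensions of `A` and `B` are at most `max #I ℵ₀`.

If `I` is uncountable and `#I < #k`, then `dim B < #k`. The residue fields of `B` are then algebraic
over `k`, because the elements `1 / (x - a)` for `a` in `k` would be linearly independent if `x`
were transcendental (`nonempty_algHom_of_rank_lt`).

If `I` is countable, then `B` has countable dimension, and the group structure is used. The image
of a homomorphism of algebraic groups is closed (`isClosed_range_of_isMonHom`). If a prime of `A i`
contains the kernel of `A i → A`, it contains the kernels of all `A i → A j`, so it lies in the
images of all the `Spec (A j)`, and hence in that of `Spec A`. Thus `A` is a union of finitely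
generated subalgebras onto whose spectra `Spec A` surjects; call such an algebra *spectrally
approximable* (`IsSpectrallyApproximable`). The property passes to `K ⊗ A`, hence to `K ⊗ B`.

It implies that every finitely generated proper ideal `J` of `B` and every `b` in `B` admit a scalar
`μ` with `J + (b - μ)` proper (`IsSpectrallyApproximable.exists_sup_span_ne_top`). To see this,
take a finitely generated approximation `E` of `K ⊗ B` that contains `b` and generators of `J`. By
Chevalley's theorem the image of `b` on `V(J) ⊆ Spec E` either is cofinite in the affine line over
`K`, so that it contains a point of the infinite field `k`, or is finite, in which case `b` is
algebraic modulo `J`. Along a countable basis of `B` this yields an increasing sequence of proper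
ideals, and modulo a maximal ideal above their union all elements of `B` are scalars
(`IsSpectrallyApproximable.nonempty_algHom`).
-/

/-! ### Constructible sets and closed subgroups -/

/-- A constructible set contains a relatively open dense subset of its closure. The localized form
(`W` may be found inside any open `U` meeting `s`) is the one stable under unions. -/
theorem Topology.IsConstructible.exists_isOpen_inter_closure_subset {X : Type*} [TopologicalSpace X]
    {s : Set X} (hs : Topology.IsConstructible s) {U : Set X} (hU : IsOpen U)
    (hUs : (U ∩ s).Nonempty) :
    ∃ W, IsOpen W ∧ W ⊆ U ∧ (W ∩ s).Nonempty ∧ W ∩ closure s ⊆ s := by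
  revert U
  refine BooleanSubalgebra.closure_sdiff_sup_induction
    (p := fun (s : Set X) _ ↦ ∀ {U : Set X}, IsOpen U → (U ∩ s).Nonempty →
      ∃ W, IsOpen W ∧ W ⊆ U ∧ (W ∩ s).Nonempty ∧ W ∩ closure s ⊆ s)
    (s := {U : Set X | IsOpen U ∧ IsRetrocompact U})
    ⟨fun a ha b hb ↦ ⟨ha.1.union hb.1, ha.2.union hb.2⟩,
      fun a ha b hb ↦ ⟨ha.1.inter hb.1, ha.2.inter_isOpen hb.2 hb.1⟩⟩
    ⟨isOpen_empty, .empty⟩ ⟨isOpen_univ, .univ⟩ ?_ ?_ s hs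
  · rintro a ⟨ha, -⟩ b ⟨hb, -⟩ U hU hne
    refine ⟨U ∩ a, hU.inter ha, Set.inter_subset_left, ?_, ?_⟩
    · obtain ⟨x, hxU, hxa, hxb⟩ := hne
      exact ⟨x, ⟨hxU, hxa⟩, hxa, hxb⟩
    · rintro x ⟨⟨-, hxa⟩, hx⟩
      have : closure (a \ b) ⊆ bᶜ := closure_minimal (fun _ h ↦ h.2) hb.isClosed_compl
      exact ⟨hxa, this hx⟩
  · intro s hs t ht ihs iht U hU hne
    by_cases h₁ : ((U ∩ (closure t)ᶜ) ∩ s).Nonempty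
    · obtain ⟨W, hW, hWU, hne, hWs⟩ := ihs (hU.inter isClosed_closure.isOpen_compl) h₁
      refine ⟨W, hW, hWU.trans Set.inter_subset_left, hne.mono (by gcongr; exact le_sup_left), ?_⟩
      rintro x ⟨hxW, hx⟩
      replace hx : x ∈ closure (s ∪ t) := hx
      rw [closure_union] at hx
      exact .inl (hWs ⟨hxW, hx.resolve_right (hWU hxW).2⟩)
    by_cases h₂ : ((U ∩ (closure s)ᶜ) ∩ t).Nonempty
    · obtain ⟨W, hW, hWU, hne, hWs⟩ := iht (hU.inter isClosed_closure.isOpen_compl) h₂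
      refine ⟨W, hW, hWU.trans Set.inter_subset_left, hne.mono (by gcongr; exact le_sup_right), ?_⟩
      rintro x ⟨hxW, hx⟩
      replace hx : x ∈ closure (s ∪ t) := hx
      rw [closure_union] at hx
      exact .inr (hWs ⟨hxW, hx.resolve_left (hWU hxW).2⟩)
    -- Inside `U` the two sets have the same closure, so the subset found for `s` serves both.
    have hts : U ∩ t ⊆ closure s := fun x hx ↦ by
      by_contra h
      exact h₂ ⟨x, ⟨hx.1, h⟩, hx.2⟩
    have hUs : (U ∩ s).Nonempty := by
      obtain ⟨x, hxU, hx | hx⟩ := hne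
      · exact ⟨x, hxU, hx⟩
      · exact mem_closure_iff.1 (hts ⟨hxU, hx⟩) U hU hxU
    obtain ⟨W, hW, hWU, hne, hWs⟩ := ihs hU hUs
    refine ⟨W, hW, hWU, hne.mono (by gcongr; exact le_sup_left), ?_⟩
    rintro x ⟨hxW, hx⟩
    replace hx : x ∈ closure (s ∪ t) := hx
    rw [closure_union] at hx
    refine .inl (hWs ⟨hxW, hx.elim id fun hxt ↦ ?_⟩)
    have := hW.inter_closure ⟨hxW, hxt⟩
    exact closure_minimal ((Set.inter_subset_inter_left _ hWU).trans hts) isClosed_closure this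

/-- In a Jacobson space, an open set that meets a constructible set meets it in a closed point. -/
theorem Topology.IsConstructible.nonempty_inter_closedPoints {X : Type*} [TopologicalSpace X]
    [JacobsonSpace X] {s : Set X} (hs : Topology.IsConstructible s) {U : Set X} (hU : IsOpen U)
    (hne : (U ∩ s).Nonempty) : ∃ x ∈ U ∩ s, IsClosed {x} := by
  obtain ⟨W, hW, hWU, hne, hWs⟩ := hs.exists_isOpen_inter_closure_subset hU hne
  obtain ⟨x, hx, hxc⟩ := _root_.nonempty_inter_closedPoints
    (hne.mono (Set.inter_subset_inter_right _ subset_closure))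
    (hW.isLocallyClosed.inter isClosed_closure.isLocallyClosed)
  exact ⟨x, ⟨hWU hx.1, hWs hx⟩, hxc⟩

/-- In a group with continuous translations and continuous inversion (such as the group of rational
points of an algebraic group with its Zariski topology), a subgroup that contains a nonempty
relatively open subset of its closure is closed. -/
theorem Subgroup.isClosed_of_isOpen_inter_closure_subset {Γ : Type*} [Group Γ] [TopologicalSpace Γ]
    (hl : ∀ g : Γ, Continuous fun x ↦ g * x) (hr : ∀ g : Γ, Continuous fun x ↦ x * g)
    (hi : Continuous fun x : Γ ↦ x⁻¹) (H : Subgroup Γ) {W : Set Γ} (hW : IsOpen W)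
    (hne : (W ∩ H).Nonempty) (hWH : W ∩ _root_.closure (H : Set Γ) ⊆ H) : IsClosed (H : Set Γ) := by
  refine isClosed_of_closure_subset fun x hx ↦ ?_
  obtain ⟨v, hvW, hv⟩ := hne
  have hxv : x * v⁻¹ ∈ _root_.closure (H : Set Γ) :=
    map_mem_closure (f := fun y ↦ y * v⁻¹) (hr v⁻¹) hx fun y hy ↦ H.mul_mem hy (H.inv_mem hv)
  obtain ⟨h, hhW, hh⟩ := mem_closure_iff.1 hxv ((fun y ↦ y⁻¹ * x) ⁻¹' W)
    (hW.preimage ((hr x).comp hi)) (by simpa [Set.mem_preimage, mul_assoc] using hvW)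
  have : h⁻¹ * x ∈ _root_.closure (H : Set Γ) :=
    map_mem_closure (f := fun y ↦ h⁻¹ * y) (hl h⁻¹) hx fun y hy ↦ H.mul_mem (H.inv_mem hh) hy
  exact (H.mul_mem_cancel_left (H.inv_mem hh)).1 (hWH ⟨hhW, this⟩)

/-! ### Spectra and field extensions -/

open scoped TensorProduct in
/-- Two homomorphisms from a ring to fields with the same kernel are equalized in a common field
extension. -/
theorem exists_field_comp_eq_comp {E κ κ' : Type u} [CommRing E] [Field κ] [Field κ']
    (a : E →+* κ) (b : E →+* κ') (h : RingHom.ker a = RingHom.ker b) :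
    ∃ (L : Type u) (_ : Field L) (f : κ →+* L) (g : κ' →+* L), f.comp a = g.comp b := by
  have : (RingHom.ker a).IsPrime := RingHom.ker_isPrime a
  let F := (RingHom.ker a).ResidueField
  let a' : F →+* κ := Ideal.ResidueField.lift _ a le_rfl fun x hx ↦ by
    simpa [RingHom.mem_ker, IsUnit.mem_submonoid_iff] using! hx
  let b' : F →+* κ' := Ideal.ResidueField.lift _ b h.le fun x hx ↦ by
    simpa [h, RingHom.mem_ker, IsUnit.mem_submonoid_iff] using! hx
  let := a'.toAlgebra
  let := b'.toAlgebra
  obtain ⟨m, hm⟩ := Ideal.exists_maximal (κ ⊗[F] κ')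
  let := Ideal.Quotient.field m
  refine ⟨(κ ⊗[F] κ') ⧸ m, inferInstance,
    (Ideal.Quotient.mk m).comp Algebra.TensorProduct.includeLeftRingHom,
    (Ideal.Quotient.mk m).comp Algebra.TensorProduct.includeRight.toRingHom, ?_⟩
  have ha (x) : a' (algebraMap E F x) = a x := Ideal.ResidueField.lift_algebraMap _ _ _ _ _
  have hb (x) : b' (algebraMap E F x) = b x := Ideal.ResidueField.lift_algebraMap _ _ _ _ _
  ext x
  have := congr($(Algebra.TensorProduct.includeLeftRingHom_comp_algebraMap
    (R := F) (A := κ) (B := κ')) (algebraMap E F x))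
  simp only [RingHom.comp_apply, RingHom.algebraMap_toAlgebra, ha] at this
  change _ = Algebra.TensorProduct.includeRight (b' (algebraMap E F x)) at this
  rw [hb] at this
  exact congr(Ideal.Quotient.mk m $this)

open scoped TensorProduct in
/-- Surjectivity on prime spectra is preserved by base change. -/
theorem PrimeSpectrum.surjective_comap_tensorProduct_map {k E A : Type u} (K : Type u) [CommRing k]
    [CommRing K] [CommRing E] [CommRing A] [Algebra k K] [Algebra k E] [Algebra k A]
    (f : E →ₐ[k] A) (hf : Function.Surjective (PrimeSpectrum.comap f.toRingHom)) :
    Function.Surjective (PrimeSpectrum.comap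
      (Algebra.TensorProduct.map (AlgHom.id K K) f).toRingHom) := by
  intro P
  obtain ⟨Q, hQ⟩ := hf (PrimeSpectrum.comap
    (Algebra.TensorProduct.includeRight (R := k) (A := K) (B := E)).toRingHom P)
  obtain ⟨L, _, u, v, huv⟩ := exists_field_comp_eq_comp
    ((algebraMap (K ⊗[k] E) P.asIdeal.ResidueField).comp
      (Algebra.TensorProduct.includeRight (R := k) (A := K) (B := E)).toRingHom)
    ((algebraMap A Q.asIdeal.ResidueField).comp f.toRingHom) (by
      have := congr(($hQ).asIdeal)
      rw [← RingHom.comap_ker, ← RingHom.comap_ker, Ideal.ker_algebraMap_residueField,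
        Ideal.ker_algebraMap_residueField]
      exact this.symm)
  let w : K ⊗[k] E →+* L := u.comp (algebraMap _ _)
  let : Algebra k L :=
    (w.comp ((Algebra.TensorProduct.includeLeftRingHom).comp (algebraMap k K))).toAlgebra
  let wK : K →ₐ[k] L :=
    { w.comp Algebra.TensorProduct.includeLeftRingHom with commutes' _ := rfl }
  let vA : A →ₐ[k] L :=
    { v.comp (algebraMap A _) with
      commutes' r := by
        have := congr($huv (algebraMap k E r))
        simp at this
        simp
        rw [← this]
        simp [RingHom.algebraMap_toAlgebra, w] }
  let W : K ⊗[k] A →ₐ[k] L := Algebra.TensorProduct.lift wK vA fun _ _ ↦ Commute.all _ _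
  have hW : W.toRingHom.comp (Algebra.TensorProduct.map (AlgHom.id K K) f).toRingHom = w := by
    apply Algebra.TensorProduct.ringHom_ext
    · ext x
      simp [W, wK]
    · ext x
      have := congr($huv x)
      simp [W, vA] at this ⊢
      exact this.symm
  refine ⟨PrimeSpectrum.comap W.toRingHom ⟨⊥, Ideal.isPrime_bot⟩, ?_⟩
  ext1
  rw [← PrimeSpectrum.comap_comp_apply, hW]
  simp only [w, PrimeSpectrum.comap_asIdeal, ← RingHom.ker_eq_comap_bot]
  rw [RingHom.ker_comp_of_injective _ u.injective, Ideal.ker_algebraMap_residueField]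

/-! ### Algebras approximated by finitely generated ones -/

/-- The `K`-algebra `S` is approximated by finitely generated subalgebras in a way that does not
lose points: every finite subset of `S` lies in a finitely generated subalgebra `E` such that
`Spec S → Spec E` is surjective. -/
def IsSpectrallyApproximable (K S : Type*) [CommRing K] [CommRing S] [Algebra K S] : Prop :=
  ∀ s : Finset S, ∃ E : Subalgebra K S, E.FG ∧ (s : Set S) ⊆ E ∧
    Function.Surjective (PrimeSpectrum.comap (algebraMap E S))

theorem AlgHom.surjective_comap_algebraMap_range {K R S : Type*} [CommRing K] [CommRing R]
    [CommRing S] [Algebra K R] [Algebra K S] (f : R →ₐ[K] S)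
    (hf : Function.Surjective (PrimeSpectrum.comap f.toRingHom)) :
    Function.Surjective (PrimeSpectrum.comap (algebraMap f.range S)) := by
  have h : f.toRingHom = (algebraMap f.range S).comp f.rangeRestrict.toRingHom := rfl
  rw [h, PrimeSpectrum.comap_comp] at hf
  exact hf.of_comp_left
    (PrimeSpectrum.comap_injective_of_surjective _ f.rangeRestrict_surjective)

theorem IsSpectrallyApproximable.of_algEquiv {K S T : Type*} [CommRing K] [CommRing S] [CommRing T]
    [Algebra K S] [Algebra K T] (h : IsSpectrallyApproximable K S) (e : S ≃ₐ[K] T) :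
    IsSpectrallyApproximable K T := by
  classical
  intro s
  obtain ⟨E, hE, hs, hsurj⟩ := h (s.image e.symm)
  refine ⟨(e.toAlgHom.comp E.val).range, ?_, fun x hx ↦ ?_,
    AlgHom.surjective_comap_algebraMap_range _ ?_⟩
  · rw [AlgHom.range_comp, Subalgebra.range_val]
    exact hE.map _
  · exact ⟨⟨e.symm x, hs (by simpa using hx)⟩, by simp⟩
  · change Function.Surjective (PrimeSpectrum.comap
      ((e : S →+* T).comp (algebraMap E S)))
    rw [PrimeSpectrum.comap_comp]
    exact hsurj.comp (PrimeSpectrum.comapEquiv e.toRingEquiv).symm.surjective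

open scoped TensorProduct in
theorem IsSpectrallyApproximable.baseChange {k A : Type u} (K : Type u) [CommRing k] [CommRing K]
    [CommRing A] [Algebra k K] [Algebra k A] (h : IsSpectrallyApproximable k A) :
    IsSpectrallyApproximable K (K ⊗[k] A) := by
  classical
  intro s
  obtain ⟨t, ht⟩ : ∃ t : Finset A, ∀ x ∈ s, ∀ E : Subalgebra k A, (t : Set A) ⊆ E →
      x ∈ E.baseChange K := by
    induction s using Finset.induction_on with
    | empty => exact ⟨∅, by simp⟩
    | insert x s hxs ih =>
      clear hxs
      obtain ⟨t, ht⟩ := ih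
      obtain ⟨t', ht'⟩ : ∃ t : Finset A, ∀ E : Subalgebra k A, (t : Set A) ⊆ E →
          x ∈ E.baseChange K := by
        induction x using TensorProduct.induction_on with
        | zero => exact ⟨∅, fun E _ ↦ zero_mem _⟩
        | tmul a b => exact ⟨{b}, fun E hE ↦ Subalgebra.tmul_mem_baseChange (by simpa using hE) a⟩
        | add x y hx hy =>
          obtain ⟨t, ht⟩ := hx
          obtain ⟨t', ht'⟩ := hy
          refine ⟨t ∪ t', fun E hE ↦ ?_⟩
          rw [Finset.coe_union, Set.union_subset_iff] at hE
          exact add_mem (ht E hE.1) (ht' E hE.2)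
      refine ⟨t' ∪ t, fun y hy E hE ↦ ?_⟩
      rw [Finset.coe_union, Set.union_subset_iff] at hE
      obtain rfl | hy := Finset.mem_insert.1 hy
      · exact ht' E hE.1
      · exact ht y hy E hE.2
  obtain ⟨E, hE, htE, hsurj⟩ := h t
  refine ⟨E.baseChange K, ?_, fun x hx ↦ ht x hx E htE,
    AlgHom.surjective_comap_algebraMap_range _
      (PrimeSpectrum.surjective_comap_tensorProduct_map K E.val hsurj)⟩
  have : Algebra.FiniteType k E := (Subalgebra.fg_iff_finiteType E).1 hE
  have : Algebra.FiniteType K (K ⊗[k] E) := inferInstance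
  exact (Subalgebra.fg_iff_finiteType _).2 (this.of_surjective
    (Algebra.TensorProduct.map (AlgHom.id K K) E.val).rangeRestrict
    (AlgHom.rangeRestrict_surjective _))

open Polynomial in
/-- A finitely generated algebra over a field and an element `b` of it: either `b` is algebraic, or
the image of `b : Spec R → 𝔸¹` contains a nonempty open subset, by Chevalley's theorem. -/
theorem exists_polynomial_aeval_eq_zero_or_not_isUnit_sub {K R : Type*} [Field K] [CommRing R]
    [Algebra K R] [Algebra.FiniteType K R] (b : R) :
    ∃ p : K[X], p ≠ 0 ∧ (aeval b p = 0 ∨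
      ∀ μ : K, p.eval μ ≠ 0 → ¬ IsUnit (b - algebraMap K R μ)) := by
  by_cases hinj : Function.Injective (aeval b : K[X] →ₐ[K] R)
  · let φ : K[X] →+* R := (aeval b : K[X] →ₐ[K] R).toRingHom
    have hφ : φ.FiniteType := by
      refine RingHom.FiniteType.of_comp_finiteType (f := algebraMap K K[X]) ?_
      have : φ.comp (algebraMap K K[X]) = algebraMap K R := (aeval b).comp_algebraMap
      rw [this]
      exact RingHom.finiteType_algebraMap.2 inferInstance
    have hc := PrimeSpectrum.isConstructible_range_comap
      (RingHom.FinitePresentation.of_finiteType.1 hφ)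
    have hd : DenseRange (PrimeSpectrum.comap φ) := by
      rw [PrimeSpectrum.denseRange_comap_iff_ker_le_nilRadical,
        (RingHom.injective_iff_ker_eq_bot φ).1 hinj]
      exact bot_le
    have : Nonempty (PrimeSpectrum K[X]) := inferInstance
    obtain ⟨W, hW, -, ⟨x, hxW, -⟩, hWs⟩ := hc.exists_isOpen_inter_closure_subset isOpen_univ
      (by simpa using! Set.range_nonempty_iff_nonempty.2 hd.nonempty)
    obtain ⟨_, ⟨f, rfl⟩, hxf, hf⟩ :=
      PrimeSpectrum.isTopologicalBasis_basic_opens.exists_subset_of_mem_open hxW hW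
    refine ⟨f, fun hf0 ↦ by simp [hf0] at hxf, .inr fun μ hμ hu ↦ ?_⟩
    obtain ⟨q, hq⟩ := hWs ⟨hf (show (⟨RingHom.ker (evalRingHom μ), RingHom.ker_isPrime _⟩ :
      PrimeSpectrum K[X]) ∈ _ from hμ), hd _⟩
    have : X - C μ ∈ (PrimeSpectrum.comap φ q).asIdeal := by simp [hq]
    have : b - algebraMap K R μ ∈ q.asIdeal := by simpa [φ] using this
    exact q.isPrime.ne_top (Ideal.eq_top_of_isUnit_mem _ this hu)
  · rw [injective_iff_map_eq_zero] at hinj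
    push Not at hinj
    obtain ⟨p, hp, hp0⟩ := hinj
    exact ⟨p, hp0, .inl hp⟩

/-! ### Existence of rational points on spectra -/

open scoped TensorProduct Polynomial in
theorem Transcendental.one_tmul {k B : Type*} (K : Type*) [Field k] [CommRing K] [Algebra k K]
    [CommRing B] [Algebra k B] {b : B} (hb : Transcendental k b) :
    Transcendental K ((1 : K) ⊗ₜ[k] b) := by
  rw [transcendental_iff_injective] at hb ⊢
  have h : (Polynomial.aeval ((1 : K) ⊗ₜ[k] b) : K[X] →ₐ[K] K ⊗[k] B) =
      (Algebra.TensorProduct.map (AlgHom.id K K) (Polynomial.aeval b)).comp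
        (polyEquivTensor' k K).toAlgHom := by
    ext
    simp
  rw [h]
  exact (Module.Flat.lTensor_preserves_injective_linearMap (M := K)
    (Polynomial.aeval b : k[X] →ₐ[k] B).toLinearMap hb).comp (polyEquivTensor' k K).injective

theorem IsAlgebraic.exists_sub_algebraMap_not_isUnit {k B : Type*} [Field k] [IsAlgClosed k]
    [CommRing B] [Nontrivial B] [Algebra k B] {b : B} (hb : IsAlgebraic k b) :
    ∃ μ : k, ¬ IsUnit (b - algebraMap k B μ) := by
  obtain ⟨m, hm⟩ := Ideal.exists_maximal B
  let := Ideal.Quotient.field m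
  have hint := (hb.algHom (Ideal.Quotient.mkₐ k m)).isIntegral
  obtain ⟨μ, hμ⟩ := minpoly.mem_range_of_degree_eq_one k _
    (IsAlgClosed.degree_eq_one_of_irreducible k (minpoly.irreducible hint))
  refine ⟨μ, fun hu ↦ hm.ne_top (Ideal.eq_top_of_isUnit_mem _ ?_ hu)⟩
  rw [← Ideal.Quotient.eq_zero_iff_mem, map_sub, sub_eq_zero]
  exact hμ.symm

theorem Ideal.isUnit_mk_of_sup_span_eq_top {R : Type*} [CommRing R] {J : Ideal R} {x : R}
    (h : J ⊔ Ideal.span {x} = ⊤) : IsUnit (Ideal.Quotient.mk J x) := by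
  obtain ⟨y, hy, z, hz, hyz⟩ := Submodule.mem_sup.1 ((Ideal.eq_top_iff_one _).1 h)
  obtain ⟨c, rfl⟩ := Ideal.mem_span_singleton'.1 hz
  have := congr(Ideal.Quotient.mk J $hyz)
  simp only [map_add, map_mul, map_one, Ideal.Quotient.eq_zero_iff_mem.2 hy, zero_add] at this
  exact .of_mul_eq_one_right _ this

open scoped TensorProduct Polynomial in
/-- The inductive step in the construction of a rational point of `Spec B`: a proper finitely
generated ideal `J` stays proper after adding `b - μ` for a suitable scalar `μ`. Over the extension
`K`, either `b` is algebraic modulo `J`, and this descends to `k`, or the values of `b` on `V(J)`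
omit only finitely many scalars, so that almost all elements of `k` are values. -/
theorem IsSpectrallyApproximable.exists_sup_span_ne_top {k K B : Type u} [Field k] [IsAlgClosed k]
    [Field K] [Algebra k K] [CommRing B] [Algebra k B]
    (h : IsSpectrallyApproximable K (K ⊗[k] B)) {J : Ideal B} (hJ : J.FG) (hJt : J ≠ ⊤) (b : B) :
    ∃ μ : k, J ⊔ Ideal.span {b - algebraMap k B μ} ≠ ⊤ := by
  classical
  let i : B →ₐ[k] K ⊗[k] B := Algebra.TensorProduct.includeRight
  obtain ⟨t, ht⟩ := hJ
  obtain ⟨E, hE, hs, hsurj⟩ := h (insert (i b) (t.image i))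
  rw [Finset.coe_insert, Set.insert_subset_iff, Finset.coe_image] at hs
  have : Algebra.FiniteType K E := (Subalgebra.fg_iff_finiteType E).1 hE
  let J₀ : Ideal E := Ideal.span {x : E | (x : K ⊗[k] B) ∈ i '' t}
  have hJ₀ : J₀.map (algebraMap E (K ⊗[k] B)) = J.map i := by
    rw [← ht, Ideal.map_span, Ideal.map_span]
    congr 1
    ext x
    exact ⟨by rintro ⟨y, hy, rfl⟩; exact hy, fun hx ↦ ⟨⟨x, hs.2 hx⟩, hx, rfl⟩⟩
  let b₀ : E := ⟨i b, hs.1⟩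
  obtain ⟨p, hp, hpb | hpb⟩ := exists_polynomial_aeval_eq_zero_or_not_isUnit_sub (K := K)
    (Ideal.Quotient.mkₐ K J₀ b₀)
  · have : Nontrivial (B ⧸ J) := Ideal.Quotient.nontrivial_iff.2 hJt
    have halg : IsAlgebraic k (Ideal.Quotient.mkₐ k J b) := by
      by_contra htr
      refine Transcendental.one_tmul K htr ⟨p, hp, ?_⟩
      let q : K ⊗[k] B →ₐ[K] K ⊗[k] (B ⧸ J) :=
        Algebra.TensorProduct.map (AlgHom.id K K) (Ideal.Quotient.mkₐ k J)
      have hq : (1 : K) ⊗ₜ[k] (Ideal.Quotient.mkₐ k J b) = q (E.val b₀) := by simp [q, b₀, i]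
      rw [hq, Polynomial.aeval_algHom_apply, Polynomial.aeval_algHom_apply]
      have hmem : Polynomial.aeval b₀ p ∈ J₀ := by
        rw [← Ideal.Quotient.eq_zero_iff_mem]
        rwa [Polynomial.aeval_algHom_apply] at hpb
      have hmem' := Ideal.mem_map_of_mem (algebraMap E (K ⊗[k] B)) hmem
      rw [hJ₀] at hmem'
      have hle : J.map i ≤ RingHom.ker q := by
        refine Ideal.map_le_iff_le_comap.2 fun x hx ↦ ?_
        simp [RingHom.mem_ker, q, i, Ideal.Quotient.eq_zero_iff_mem.2 hx]
      exact hle hmem'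
    obtain ⟨μ, hμ⟩ := halg.exists_sub_algebraMap_not_isUnit
    exact ⟨μ, fun htop ↦ hμ (Ideal.isUnit_mk_of_sup_span_eq_top htop)⟩
  · have : Infinite k := IsAlgClosed.instInfinite
    obtain ⟨_, ⟨μ, rfl⟩, hμ⟩ := (Set.infinite_range_of_injective
      (algebraMap k K).injective).exists_notMem_finset p.roots.toFinset
    rw [Multiset.mem_toFinset, Polynomial.mem_roots hp] at hμ
    refine ⟨μ, fun htop ↦ hpb _ hμ ?_⟩
    -- Properness can be tested in `E`, because `Spec (K ⊗ B) → Spec E` is surjective.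
    have htop' : J₀ ⊔ Ideal.span {b₀ - algebraMap K E (algebraMap k K μ)} = ⊤ := by
      by_contra hne
      obtain ⟨m, hm, hle⟩ := Ideal.exists_le_maximal _ hne
      obtain ⟨Q, hQ⟩ := hsurj ⟨m, hm.isPrime⟩
      refine Q.isPrime.ne_top (top_le_iff.1 ?_)
      have hmQ : m.map (algebraMap E (K ⊗[k] B)) ≤ Q.asIdeal :=
        Ideal.map_le_iff_le_comap.2 congr(($hQ).asIdeal).ge
      refine le_trans ?_ ((Ideal.map_mono hle).trans hmQ)
      rw [Ideal.map_sup, hJ₀, Ideal.map_span, Set.image_singleton]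
      have := congr(Ideal.map i $htop)
      rw [Ideal.map_sup, Ideal.map_span, Set.image_singleton, Ideal.map_top] at this
      have hb₀ : algebraMap E (K ⊗[k] B) (b₀ - algebraMap K E (algebraMap k K μ)) =
          i (b - algebraMap k B μ) := by
        rw [map_sub, map_sub, AlgHom.commutes, ← IsScalarTower.algebraMap_apply K E,
          ← IsScalarTower.algebraMap_apply k K]
        rfl
      rw [← this, hb₀]
    exact Ideal.isUnit_mk_of_sup_span_eq_top htop'

theorem nonempty_algHom_of_surjective_algebraMap_quotient {k B : Type*} [Field k] [CommRing B]
    [Algebra k B] (m : Ideal B) [m.IsMaximal]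
    (h : Function.Surjective (algebraMap k (B ⧸ m))) : Nonempty (B →ₐ[k] k) :=
  ⟨(AlgEquiv.ofBijective (Algebra.ofId k (B ⧸ m))
    ⟨(algebraMap k (B ⧸ m)).injective, h⟩).symm.toAlgHom.comp (Ideal.Quotient.mkₐ k m)⟩

/-- The Nullstellensatz for algebras whose dimension is less than the cardinality of the ground
field. -/
theorem nonempty_algHom_of_rank_lt {k B : Type u} [Field k] [IsAlgClosed k] [CommRing B]
    [Nontrivial B] [Algebra k B] (h : Module.rank k B < Cardinal.mk k) : Nonempty (B →ₐ[k] k) := by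
  obtain ⟨m, hm⟩ := Ideal.exists_maximal B
  let := Ideal.Quotient.field m
  have : Algebra.IsAlgebraic k (B ⧸ m) := by
    by_contra hna
    obtain ⟨x, hx⟩ := Algebra.transcendental_iff_not_isAlgebraic.2 hna
    have h₁ := hx.linearIndependent_sub_inv.cardinal_le_rank
    exact (h₁.trans ((Ideal.Quotient.mkₐ k m).toLinearMap.rank_le_of_surjective
      (Ideal.Quotient.mkₐ_surjective k m))).not_gt h
  exact nonempty_algHom_of_surjective_algebraMap_quotient m
    IsAlgClosed.algebraMap_bijective_of_isIntegral.2

open scoped TensorProduct in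
/-- A nonzero algebra `B` of countable dimension over an algebraically closed field `k` has a
rational point as soon as some base change of it is spectrally approximable: running through a
countable basis, one builds an increasing sequence of proper ideals modulo which more and more
basis vectors become scalars. -/
theorem IsSpectrallyApproximable.nonempty_algHom {k K B : Type u} [Field k] [IsAlgClosed k]
    [Field K] [Algebra k K] [CommRing B] [Nontrivial B] [Algebra k B]
    (h : IsSpectrallyApproximable K (K ⊗[k] B)) (hB : Module.rank k B ≤ Cardinal.aleph0) :
    Nonempty (B →ₐ[k] k) := by
  let e := Module.Free.chooseBasis k B
  have : Countable (Module.Free.ChooseBasisIndex k B) := by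
    rwa [← Cardinal.mk_le_aleph0_iff, ← Module.Free.rank_eq_card_chooseBasisIndex]
  have : Nonempty (Module.Free.ChooseBasisIndex k B) := e.index_nonempty
  obtain ⟨f, hf⟩ := exists_surjective_nat (Module.Free.ChooseBasisIndex k B)
  choose μ hμ using fun (J : {J : Ideal B // J.FG ∧ J ≠ ⊤}) (b : B) ↦
    h.exists_sup_span_ne_top J.2.1 J.2.2 b
  let J : ℕ → {J : Ideal B // J.FG ∧ J ≠ ⊤} := Nat.rec ⟨⊥, Submodule.fg_bot, bot_ne_top⟩
    fun n I ↦ ⟨I.1 ⊔ Ideal.span {e (f n) - algebraMap k B (μ I (e (f n)))},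
      Submodule.FG.sup I.2.1 (Submodule.fg_span_singleton _), hμ _ _⟩
  have hmono : Monotone fun n ↦ (J n).1 := monotone_nat_of_le_succ fun n ↦ le_sup_left
  have hne : (⨆ n, (J n).1) ≠ ⊤ := by
    rw [Ne, Ideal.eq_top_iff_one, Submodule.mem_iSup_of_directed _ hmono.directed_le]
    rintro ⟨n, hn⟩
    exact (J n).2.2 ((Ideal.eq_top_iff_one _).2 hn)
  obtain ⟨m, hm, hle⟩ := Ideal.exists_le_maximal _ hne
  refine nonempty_algHom_of_surjective_algebraMap_quotient m fun x ↦ ?_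
  obtain ⟨x, rfl⟩ := Ideal.Quotient.mk_surjective x
  suffices ⊤ ≤ (LinearMap.range (Algebra.linearMap k (B ⧸ m))).comap
      (Ideal.Quotient.mkₐ k m).toLinearMap from this (Submodule.mem_top (x := x))
  rw [← e.span_eq, Submodule.span_le]
  rintro _ ⟨j, rfl⟩
  obtain ⟨n, rfl⟩ := hf j
  refine ⟨μ (J n) (e (f n)), ?_⟩
  have : e (f n) - algebraMap k B (μ (J n) (e (f n))) ∈ m :=
    hle (Submodule.mem_iSup_of_mem (n + 1) (le_sup_right (a := (J n).1)
      (Ideal.mem_span_singleton_self _)))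
  rw [← Ideal.Quotient.eq_zero_iff_mem, map_sub, sub_eq_zero] at this
  exact this.symm

/-! ### Homomorphisms of algebraic groups have closed image -/

section ClosedImage

variable {k : Type u} [Field k]

/-- The point of the underlying topological space of `X` that is given by a `k`-rational point. -/
noncomputable def pointOfSection {X : SchemeOver k} (x : 𝟙_ (SchemeOver k) ⟶ X) : X.left :=
  x.left (IsLocalRing.closedPoint k)

theorem pointOfSection_comp {X Y : SchemeOver k} (x : 𝟙_ (SchemeOver k) ⟶ X) (f : X ⟶ Y) :
    pointOfSection (x ≫ f) = f.left (pointOfSection x) :=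
  rfl

variable [IsAlgClosed k]

theorem pointOfSection_injective {X : SchemeOver k} [LocallyOfFiniteType X.hom] :
    Function.Injective (pointOfSection (X := X)) := fun x y h ↦
  Over.OverMorphism.ext (ext_of_apply_closedPoint_eq X.hom (Over.w x) (Over.w y) h)

theorem isClosed_pointOfSection {X : SchemeOver k} [LocallyOfFiniteType X.hom]
    (x : 𝟙_ (SchemeOver k) ⟶ X) : IsClosed {pointOfSection x} :=
  (pointEquivClosedPoint X.hom ⟨x.left, Over.w x⟩).2

theorem exists_pointOfSection_eq {X : SchemeOver k} [LocallyOfFiniteType X.hom] {x : X.left}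
    (hx : IsClosed {x}) : ∃ y : 𝟙_ (SchemeOver k) ⟶ X, pointOfSection y = x :=
  ⟨Over.homMk (pointOfClosedPoint X.hom x hx) (pointOfClosedPoint_comp X.hom x hx),
    pointOfClosedPoint_apply X.hom x hx _⟩

open MonObj in
/-- The image of a homomorphism of algebraic groups over an algebraically closed field is closed.
The image is constructible, so this can be checked on rational points, where the image is a
subgroup containing a nonempty open subset of its closure. -/
theorem isClosed_range_of_isMonHom {G H : SchemeOver k} [GrpObj G] [GrpObj H] [IsAffine G.left]
    [IsAffine H.left] [LocallyOfFiniteType G.hom] [LocallyOfFiniteType H.hom] (f : G ⟶ H)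
    [IsMonHom f] : IsClosed (Set.range f.left) := by
  have : IsNoetherian H.left := { __ := LocallyOfFiniteType.isLocallyNoetherian H.hom }
  have : JacobsonSpace H.left := LocallyOfFiniteType.jacobsonSpace H.hom
  have : JacobsonSpace G.left := LocallyOfFiniteType.jacobsonSpace G.hom
  have : LocallyOfFiniteType (f.left ≫ H.hom) := by rwa [Over.w f]
  have : LocallyOfFiniteType f.left := locallyOfFiniteType_of_comp f.left H.hom
  have : LocallyOfFinitePresentation f.left :=
    LocallyOfFinitePresentation.iff_locallyOfFiniteType.2 this
  have hc : Topology.IsConstructible (Set.range f.left) := by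
    rw [← Set.image_univ]
    exact f.left.isConstructible_image .univ
  have : Nonempty G.left := ⟨pointOfSection (1 : 𝟙_ (SchemeOver k) ⟶ G)⟩
  let : TopologicalSpace (𝟙_ (SchemeOver k) ⟶ H) := .induced pointOfSection inferInstance
  have hpt : Continuous (pointOfSection (X := H)) := continuous_induced_dom
  let Γ : Subgroup (𝟙_ (SchemeOver k) ⟶ H) :=
    { carrier := {x | ∃ y, y ≫ f = x}
      mul_mem' := by
        rintro _ _ ⟨x, rfl⟩ ⟨y, rfl⟩
        exact ⟨x * y, MonObj.mul_comp ..⟩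
      one_mem' := ⟨1, MonObj.one_comp f⟩
      inv_mem' := by
        rintro _ ⟨x, rfl⟩
        exact ⟨x⁻¹, GrpObj.inv_comp ..⟩ }
  have hΓ (x : 𝟙_ (SchemeOver k) ⟶ H) : x ∈ Γ ↔ pointOfSection x ∈ Set.range f.left := by
    refine ⟨fun ⟨y, hy⟩ ↦ ⟨_, congr(pointOfSection $hy)⟩, fun ⟨z, hz⟩ ↦ ?_⟩
    obtain ⟨z', hz', hzc⟩ := nonempty_inter_closedPoints (Z := f.left ⁻¹' {pointOfSection x})
      ⟨z, hz⟩ ((isClosed_pointOfSection x).preimage f.left.continuous).isLocallyClosed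
    obtain ⟨y, rfl⟩ := exists_pointOfSection_eq hzc
    exact ⟨y, pointOfSection_injective hz'⟩
  obtain ⟨W, hW, -, hne, hWs⟩ := hc.exists_isOpen_inter_closure_subset isOpen_univ
    (by simpa using Set.range_nonempty f.left)
  have hclosed : IsClosed (Γ : Set (𝟙_ (SchemeOver k) ⟶ H)) := by
    refine Γ.isClosed_of_isOpen_inter_closure_subset (W := pointOfSection ⁻¹' W)
      (fun g ↦ ?_) (fun g ↦ ?_) ?_ (hW.preimage hpt) ?_ ?_
    · refine continuous_induced_rng.2 ?_
      have (x : 𝟙_ (SchemeOver k) ⟶ H) : pointOfSection (g * x) =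
          ((toUnit H ≫ g) * 𝟙 H : H ⟶ H).left (pointOfSection x) := by
        rw [← pointOfSection_comp, MonObj.comp_mul]
        simp
      exact (((toUnit H ≫ g) * 𝟙 H : H ⟶ H).left.continuous.comp hpt).congr fun x ↦ (this x).symm
    · refine continuous_induced_rng.2 ?_
      have (x : 𝟙_ (SchemeOver k) ⟶ H) : pointOfSection (x * g) =
          (𝟙 H * (toUnit H ≫ g) : H ⟶ H).left (pointOfSection x) := by
        rw [← pointOfSection_comp, MonObj.comp_mul]
        simp
      exact ((𝟙 H * (toUnit H ≫ g) : H ⟶ H).left.continuous.comp hpt).congr fun x ↦ (this x).symm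
    · exact continuous_induced_rng.2 (ι[H].left.continuous.comp hpt)
    · obtain ⟨x, ⟨hxW, hx⟩, hxc⟩ := hc.nonempty_inter_closedPoints hW hne
      obtain ⟨y, rfl⟩ := exists_pointOfSection_eq hxc
      exact ⟨y, hxW, (hΓ y).2 hx⟩
    · rintro x ⟨hxW, hx⟩
      exact (hΓ x).2 (hWs ⟨hxW, map_mem_closure hpt hx fun y hy ↦ (hΓ y).1 hy⟩)
  obtain ⟨C, hC, hCΓ⟩ := isClosed_induced_iff.1 hclosed
  have hcl : Topology.IsConstructible (closure (Set.range f.left)) := by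
    rw [← Topology.isConstructible_compl]
    exact (TopologicalSpace.NoetherianSpace.isCompact _).isConstructible
      isClosed_closure.isOpen_compl
  by_contra hncl
  have hne' : (Set.univ ∩ (closure (Set.range f.left) \ Set.range f.left)).Nonempty := by
    rw [Set.univ_inter, Set.sdiff_nonempty]
    exact fun h ↦ hncl (isClosed_of_closure_subset h)
  obtain ⟨x, ⟨-, hx, hx'⟩, hxc⟩ := (hcl.sdiff hc).nonempty_inter_closedPoints isOpen_univ hne'
  obtain ⟨x, rfl⟩ := exists_pointOfSection_eq hxc
  have hxC : pointOfSection x ∈ Cᶜ := fun h ↦ hx' ((hΓ x).1 (hCΓ.le h))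
  obtain ⟨y, ⟨hyC, hy⟩, hyc⟩ := hc.nonempty_inter_closedPoints hC.isOpen_compl
    (mem_closure_iff.1 hx _ hC.isOpen_compl hxC)
  obtain ⟨y, rfl⟩ := exists_pointOfSection_eq hyc
  exact hyC (hCΓ.ge ((hΓ y).2 hy))

end ClosedImage

/-! ### Limits of group objects -/

open MonObj in
/-- A monoid object that is a limit of group objects is a group object. -/
noncomputable abbrev grpObjOfIsLimit {C J : Type*} [Category* C] [CartesianMonoidalCategory C]
    [Category* J] {F : J ⥤ C} [∀ j, GrpObj (F.obj j)] [∀ {i j} (f : i ⟶ j), IsMonHom (F.map f)]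
    {c : Cone F} [MonObj c.pt] (hc : ∀ j, IsMonHom (M := c.pt) (N := F.obj j) (c.π.app j))
    (h : IsLimit c) : GrpObj c.pt where
  inv := h.lift
    { pt := c.pt
      π.app j := c.π.app j ≫ ι[F.obj j]
      π.naturality i j f := by
        simp only [Functor.const_obj_obj, Functor.const_obj_map, Category.id_comp, Category.assoc]
        rw [← c.w f, Category.assoc, GrpObj.inv_hom] }
  left_inv := h.hom_ext fun j ↦ by
    have := hc j
    simp only [Functor.const_obj_obj, Category.assoc] at this ⊢
    rw [IsMonHom.mul_hom, IsMonHom.one_hom, lift_map_assoc, h.fac, Category.id_comp]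
    simp
  right_inv := h.hom_ext fun j ↦ by
    have := hc j
    simp only [Functor.const_obj_obj, Category.assoc] at this ⊢
    rw [IsMonHom.mul_hom, IsMonHom.one_hom, lift_map_assoc, h.fac, Category.id_comp]
    simp

/-- A limit of group objects is computed in the ambient category if the limit exists there. -/
instance preservesLimit_grp_forget {C J : Type*} [Category* C] [CartesianMonoidalCategory C]
    [Category* J] (D : J ⥤ Grp C) [HasLimit (D ⋙ Grp.forget C)] :
    PreservesLimit D (Grp.forget C) := by
  have : HasLimit ((D ⋙ Grp.forget₂Mon C) ⋙ Mon.forget C) := ‹_›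
  have : HasLimit (D ⋙ Grp.forget₂Mon C) := hasLimit_of_created _ (Mon.forget C)
  have : PreservesLimit (D ⋙ Grp.forget₂Mon C) (Mon.forget C) :=
    preservesLimit_of_createsLimit_and_hasLimit _ _
  let : GrpObj (limit (D ⋙ Grp.forget₂Mon C)).X :=
    let (j : J) : GrpObj (((D ⋙ Grp.forget₂Mon C) ⋙ Mon.forget C).obj j) := (D.obj j).grp
    have {i j : J} (f : i ⟶ j) : IsMonHom (((D ⋙ Grp.forget₂Mon C) ⋙ Mon.forget C).map f) :=
      (D.map f).hom.isMonHom_hom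
    let : MonObj ((Mon.forget C).mapCone (limit.cone (D ⋙ Grp.forget₂Mon C))).pt :=
      (limit (D ⋙ Grp.forget₂Mon C)).mon
    grpObjOfIsLimit
      (fun j ↦ (limit.π (D ⋙ Grp.forget₂Mon C) j).isMonHom_hom)
      (isLimitOfPreserves (Mon.forget C) (limit.isLimit (D ⋙ Grp.forget₂Mon C)))
  let : CreatesLimit D (Grp.forget₂Mon C) :=
    createsLimitOfFullyFaithfulOfIso (X := ⟨(limit (D ⋙ Grp.forget₂Mon C)).X⟩) (.refl _)
  have : PreservesLimit D (Grp.forget₂Mon C) := preservesLimit_of_createsLimit_and_hasLimit _ _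
  exact inferInstanceAs (PreservesLimit D (Grp.forget₂Mon C ⋙ Mon.forget C))

/-! ### Inverse limits of affine group schemes -/

/-- A cofiltered diagram of affine schemes over a base has a limit. -/
theorem hasLimit_of_isAffine {S : Scheme.{u}} {J : Type u} [SmallCategory J] [IsCofiltered J]
    (D : J ⥤ Over S) [∀ j, IsAffine (D.obj j).left] : HasLimit D := by
  let F : J ⥤ AffineScheme.{u} := ObjectProperty.lift _ (D ⋙ Over.forget S) fun j ↦
    essImage_Spec.2 (inferInstance : IsAffine (D.obj j).left)
  have := IsCofiltered.isConnected J
  have : HasLimit (F ⋙ AffineScheme.forgetToScheme) := inferInstance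
  have : HasLimit (D ⋙ Over.forget S) := this
  exact hasLimit_of_created D (Over.forget S)

section LimitOfSchemes

variable {k : Type u} [Field k] {I : Type u} [Preorder I] [IsDirectedOrder I] [Nonempty I]
  {D : Iᵒᵖ ⥤ GroupSchemeOver k} {c : Cone D}

/-- The limit in the category of group schemes is also a limit of schemes, so that its coordinate
ring is the directed colimit of the coordinate rings. -/
theorem nonempty_isLimit_mapCone (hD : ∀ i, IsAffine (D.obj i).X.left) (hc : IsLimit c) :
    Nonempty (IsLimit ((Grp.forget (SchemeOver k) ⋙ Over.forget _).mapCone c)) := by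
  have (i : Iᵒᵖ) : IsAffine ((D ⋙ Grp.forget (SchemeOver k)).obj i).left := hD i
  have := hasLimit_of_isAffine (D ⋙ Grp.forget (SchemeOver k))
  have := IsCofiltered.isConnected Iᵒᵖ
  exact ⟨isLimitOfPreserves (Over.forget _) (isLimitOfPreserves (Grp.forget _) hc)⟩

end LimitOfSchemes

/-! ### Directed colimits of algebras -/

section DirectedColimit

variable {k : Type*} [Field k] {I : Type*} [Preorder I] [IsDirectedOrder I] [Nonempty I]
  {R : I → Type*} [∀ i, CommRing (R i)] [∀ i, Algebra k (R i)]
  {A : Type*} [CommRing A] [Algebra k A]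
  (f : ∀ i j, i ≤ j → R i →ₐ[k] R j) (φ : ∀ i, R i →ₐ[k] A)

/-- A directed colimit of algebras of finite type is spectrally approximable as soon as the
transition maps induce maps with closed image on prime spectra. -/
theorem IsSpectrallyApproximable.of_directed [∀ i, Algebra.FiniteType k (R i)]
    (hf : ∀ i j l (hij : i ≤ j) (hjl : j ≤ l) (x : R i),
      f j l hjl (f i j hij x) = f i l (hij.trans hjl) x)
    (hφ : ∀ i j (hij : i ≤ j) (x : R i), φ j (f i j hij x) = φ i x)
    (hsurj : ∀ a : A, ∃ i x, φ i x = a)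
    (hker : ∀ i (x : R i), φ i x = 0 → ∃ j, ∃ hij : i ≤ j, f i j hij x = 0)
    (hclosed : ∀ i j (hij : i ≤ j),
      IsClosed (Set.range (PrimeSpectrum.comap (f i j hij).toRingHom))) :
    IsSpectrallyApproximable k A := by
  classical
  intro s
  obtain ⟨i, hi⟩ : ∃ i, (s : Set A) ⊆ (φ i).range := by
    induction s using Finset.induction_on with
    | empty => exact ⟨Classical.arbitrary I, by simp⟩
    | insert a s has ih =>
      obtain ⟨i, hi⟩ := ih
      obtain ⟨j, x, rfl⟩ := hsurj a
      obtain ⟨l, hil, hjl⟩ := exists_ge_ge i j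
      refine ⟨l, ?_⟩
      rw [Finset.coe_insert, Set.insert_subset_iff]
      refine ⟨⟨f j l hjl x, hφ ..⟩, fun b hb ↦ ?_⟩
      obtain ⟨y, rfl⟩ := hi hb
      exact ⟨f i l hil y, hφ ..⟩
  refine ⟨(φ i).range, (Subalgebra.fg_iff_finiteType _).2 (Algebra.FiniteType.of_surjective
    (φ i).rangeRestrict (φ i).rangeRestrict_surjective), hi, fun p ↦ ?_⟩
  let q := PrimeSpectrum.comap (φ i).rangeRestrict.toRingHom p
  -- An element of `R i` whose image lies in the extension of `q` does so at a finite level.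
  have hlift (a : A) (ha : a ∈ q.asIdeal.map (φ i).toRingHom) :
      ∃ j, ∃ hij : i ≤ j, ∃ x ∈ q.asIdeal.map (f i j hij).toRingHom, φ j x = a := by
    induction ha using Submodule.span_induction with
    | mem a ha =>
      obtain ⟨x, hx, rfl⟩ := ha
      exact ⟨i, le_rfl, _, Ideal.mem_map_of_mem _ hx, hφ ..⟩
    | zero => exact ⟨i, le_rfl, 0, zero_mem _, map_zero _⟩
    | add a b _ _ ha hb =>
      obtain ⟨j, hij, x, hx, rfl⟩ := ha
      obtain ⟨l, hil, y, hy, rfl⟩ := hb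
      obtain ⟨m, hjm, hlm⟩ := exists_ge_ge j l
      have hmap (j) (hij : i ≤ j) (hjm : j ≤ m) : q.asIdeal.map (f i m (hij.trans hjm)).toRingHom =
          (q.asIdeal.map (f i j hij).toRingHom).map (f j m hjm).toRingHom := by
        rw [Ideal.map_map]
        congr 1
        exact RingHom.ext fun x ↦ (hf ..).symm
      refine ⟨m, hij.trans hjm, f j m hjm x + f l m hlm y, add_mem ?_ ?_, by simp [hφ]⟩
      · rw [hmap j hij hjm]
        exact Ideal.mem_map_of_mem (f j m hjm).toRingHom hx
      · rw [hmap l hil hlm]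
        exact Ideal.mem_map_of_mem (f l m hlm).toRingHom hy
    | smul a b _ hb =>
      obtain ⟨j, hij, x, hx, rfl⟩ := hb
      obtain ⟨l, y, rfl⟩ := hsurj a
      obtain ⟨m, hjm, hlm⟩ := exists_ge_ge j l
      refine ⟨m, hij.trans hjm, f l m hlm y * f j m hjm x, Ideal.mul_mem_left _ _ ?_, by simp [hφ]⟩
      have : (f i m (hij.trans hjm)).toRingHom = (f j m hjm).toRingHom.comp (f i j hij).toRingHom :=
        RingHom.ext fun x ↦ (hf ..).symm
      rw [this, ← Ideal.map_map]
      exact Ideal.mem_map_of_mem (f j m hjm).toRingHom hx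
  obtain ⟨Q, hQ⟩ : q ∈ Set.range (PrimeSpectrum.comap (φ i).toRingHom) := by
    refine (PrimeSpectrum.mem_range_comap_iff _).2 (le_antisymm (fun x hx ↦ ?_) Ideal.le_comap_map)
    obtain ⟨j, hij, y, hy, hxy⟩ := hlift _ hx
    obtain ⟨l, hjl, hl⟩ := hker j (f i j hij x - y) (by
      rw [map_sub, hφ, hxy]
      exact sub_self _)
    have hxl : f i l (hij.trans hjl) x ∈ q.asIdeal.map (f i l (hij.trans hjl)).toRingHom := by
      have : (f i l (hij.trans hjl)).toRingHom = (f j l hjl).toRingHom.comp (f i j hij).toRingHom :=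
        RingHom.ext fun x ↦ (hf ..).symm
      rw [map_sub, hf, sub_eq_zero] at hl
      rw [hl, this, ← Ideal.map_map]
      exact Ideal.mem_map_of_mem (f j l hjl).toRingHom hy
    -- The closed image of `Spec (R l)` is the zero locus of the kernel, which `q` contains.
    have hq : q ∈ Set.range (PrimeSpectrum.comap (f i l (hij.trans hjl)).toRingHom) := by
      rw [← (hclosed i l _).closure_eq, PrimeSpectrum.closure_range_comap,
        PrimeSpectrum.mem_zeroLocus]
      intro z hz
      have hz0 : (φ i).rangeRestrict z = 0 := Subtype.ext <| by
        have : f i l (hij.trans hjl) z = 0 := hz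
        simp [← hφ i l (hij.trans hjl) z, this]
      change (φ i).rangeRestrict z ∈ p.asIdeal
      rw [hz0]
      exact zero_mem _
    obtain ⟨Q, hQ⟩ := hq
    rw [← hQ]
    refine (Ideal.map_le_iff_le_comap.2 ?_ : q.asIdeal.map _ ≤ Q.asIdeal) hxl
    exact congr(($hQ).asIdeal).ge
  refine ⟨Q, PrimeSpectrum.comap_injective_of_surjective _ (φ i).rangeRestrict_surjective ?_⟩
  exact hQ

end DirectedColimit

theorem Algebra.FiniteType.rank_le_aleph0 (k R : Type*) [Field k] [CommRing R] [Algebra k R]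
    [h : Algebra.FiniteType k R] : Module.rank k R ≤ Cardinal.aleph0 := by
  obtain ⟨n, g, hg⟩ := Algebra.FiniteType.iff_quotient_mvPolynomial''.1 h
  have := LinearMap.lift_rank_le_of_surjective g.toLinearMap hg
  rw [← Cardinal.lift_le_aleph0]
  refine this.trans ?_
  rw [Cardinal.lift_le_aleph0, MvPolynomial.rank_eq_lift, Cardinal.lift_le_aleph0]
  exact Cardinal.mk_le_aleph0

/-- The dimension of a union of the images of countably generated algebras. -/
theorem rank_le_max_of_surjective {k A I : Type u} [Field k] [CommRing A] [Algebra k A]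
    {R : I → Type u} [∀ i, CommRing (R i)] [∀ i, Algebra k (R i)] [∀ i, Algebra.FiniteType k (R i)]
    (φ : ∀ i, R i →ₐ[k] A) (hsurj : ∀ a : A, ∃ i x, φ i x = a) :
    Module.rank k A ≤ max (Cardinal.mk I) Cardinal.aleph0 := by
  let e (i : I) := Module.Free.chooseBasis k (R i)
  let b : (Σ i, Module.Free.ChooseBasisIndex k (R i)) → A := fun x ↦ φ x.1 (e x.1 x.2)
  have hspan : Submodule.span k (Set.range b) = ⊤ := by
    refine top_le_iff.1 fun a _ ↦ ?_
    obtain ⟨i, x, rfl⟩ := hsurj a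
    have hx : x ∈ Submodule.span k (Set.range (e i)) := by simp [(e i).span_eq]
    have := Submodule.mem_map_of_mem (f := (φ i).toLinearMap) hx
    rw [Submodule.map_span] at this
    refine Submodule.span_mono ?_ this
    rintro _ ⟨_, ⟨j, rfl⟩, rfl⟩
    exact ⟨⟨i, j⟩, rfl⟩
  rw [← rank_top, ← hspan]
  refine (rank_span_le _).trans (Cardinal.mk_range_le.trans ?_)
  rw [Cardinal.mk_sigma]
  refine (Cardinal.sum_le_sum _ (fun _ ↦ Cardinal.aleph0) fun i ↦ ?_).trans ?_
  · rw [← Module.Free.rank_eq_card_chooseBasisIndex]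
    exact Algebra.FiniteType.rank_le_aleph0 k (R i)
  · rw [Cardinal.sum_const']
    exact Cardinal.mul_le_max_of_aleph0_le_right le_rfl

/-! ### Coordinate rings -/

section CoordRing

variable {k : Type u} [Field k]

/-- The ring of global functions on a `k`-scheme, as a `k`-algebra. -/
def CoordRing (X : SchemeOver k) : Type u := Γ(X.left, ⊤)

noncomputable instance (X : SchemeOver k) : CommRing (CoordRing X) :=
  inferInstanceAs (CommRing Γ(X.left, ⊤))

noncomputable instance (X : SchemeOver k) : Algebra k (CoordRing X) :=
  ((X.hom.appTop).hom.comp (Scheme.ΓSpecIso (.of k)).inv.hom).toAlgebra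

/-- The pullback of functions along a morphism of `k`-schemes. -/
noncomputable def CoordRing.map {X Y : SchemeOver k} (f : X ⟶ Y) : CoordRing Y →ₐ[k] CoordRing X :=
  { f.left.appTop.hom with
    commutes' r := by
      have := congr(($(Over.w f)).appTop.hom ((Scheme.ΓSpecIso (.of k)).inv.hom r))
      exact this }

theorem CoordRing.map_comp {X Y Z : SchemeOver k} (f : X ⟶ Y) (g : Y ⟶ Z) (x : CoordRing Z) :
    CoordRing.map (f ≫ g) x = CoordRing.map f (CoordRing.map g x) :=
  rfl

/-- An affine `k`-scheme is the spectrum of its coordinate ring. -/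
noncomputable def isoAlgSpec (X : SchemeOver k) [IsAffine X.left] :
    X ≅ (algSpec (.of k)).obj (.op (CommAlgCat.of k (CoordRing X))) :=
  Over.isoMk X.left.isoSpec (by
    have h : Spec.map (CommRingCat.ofHom (algebraMap k (CoordRing X))) =
        Spec.map X.hom.appTop ≫ Spec.map (Scheme.ΓSpecIso (.of k)).inv := by
      rw [← Spec.map_comp]
      rfl
    have h' : X.left.isoSpec.hom ≫ Spec.map X.hom.appTop ≫
        Spec.map (Scheme.ΓSpecIso (.of k)).inv = X.hom := by
      rw [Scheme.isoSpec_hom_naturality_assoc]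
      simp
    exact congr(X.left.isoSpec.hom ≫ $h).trans h')

instance {X : SchemeOver k} [IsAffine X.left] [LocallyOfFiniteType X.hom] :
    Algebra.FiniteType k (CoordRing X) := by
  rw [← RingHom.finiteType_algebraMap]
  exact RingHom.FiniteType.comp
    (HasRingHomProperty.appTop @LocallyOfFiniteType X.hom inferInstance)
    (RingHom.FiniteType.of_surjective _
      (Scheme.ΓSpecIso (.of k)).symm.commRingCatIsoToRingEquiv.surjective)

theorem CoordRing.isClosed_range_comap_map {X Y : SchemeOver k} [IsAffine X.left] [IsAffine Y.left]
    (f : X ⟶ Y) (hf : IsClosed (Set.range f.left)) :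
    IsClosed (Set.range (PrimeSpectrum.comap (CoordRing.map f).toRingHom)) := by
  have h := Scheme.isoSpec_hom_naturality f.left
  have hr : Set.range (Spec.map f.left.appTop) = Y.left.isoSpec.hom '' Set.range f.left := by
    rw [← Set.range_comp, ← X.left.isoSpec.hom.surjective.range_comp]
    exact congr_arg Set.range (funext fun x ↦ by
      simp only [Function.comp_apply, ← Scheme.Hom.comp_apply, h])
  change IsClosed (Set.range (Spec.map f.left.appTop))
  rw [hr]
  exact Y.left.isoSpec.hom.homeomorph.isClosedMap _ hf

end CoordRing

/-! ### The coordinate ring of a limit of algebraic groups -/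

section Limit

variable {k : Type u} [Field k] {I : Type u} [PartialOrder I] [IsDirectedOrder I] [Nonempty I]
  {D : Iᵒᵖ ⥤ GroupSchemeOver k} {c : Cone D}

/-- The homomorphism of coordinate rings given by a transition map. -/
noncomputable def transitionMap (D : Iᵒᵖ ⥤ GroupSchemeOver k) (i j : I) (h : i ≤ j) :
    CoordRing (D.obj (.op i)).X →ₐ[k] CoordRing (D.obj (.op j)).X :=
  CoordRing.map (D.map (homOfLE h).op).hom.hom

/-- Every function on the limit comes from a finite level. -/
theorem exists_coordRing_map_eq (hD : ∀ i, IsAffine (D.obj i).X.left) (hc : IsLimit c)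
    (a : CoordRing c.pt.X) :
    ∃ (i : I) (x : _), CoordRing.map (c.π.app (.op i)).hom.hom x = a := by
  obtain ⟨h⟩ := nonempty_isLimit_mapCone hD hc
  have (i : Iᵒᵖ) : IsAffine ((D ⋙ Grp.forget (SchemeOver k) ⋙ Over.forget _).obj i) := hD i
  obtain ⟨i, x, hx⟩ := exists_appTop_π_eq_of_isAffine_of_isLimit _ _ h a
  exact ⟨i.unop, x, hx⟩

/-- A function that vanishes on the limit vanishes at a finite level. -/
theorem exists_transitionMap_eq_zero (hD : ∀ i, IsAffine (D.obj i).X.left) (hc : IsLimit c)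
    (i : I) (x : CoordRing (D.obj (.op i)).X)
    (hx : CoordRing.map (c.π.app (.op i)).hom.hom x = 0) :
    ∃ (j : I) (h : i ≤ j), transitionMap D i j h x = 0 := by
  obtain ⟨h⟩ := nonempty_isLimit_mapCone hD hc
  have (i : Iᵒᵖ) : IsAffine ((D ⋙ Grp.forget (SchemeOver k) ⋙ Over.forget _).obj i) := hD i
  obtain ⟨j, f, hj⟩ := exists_appTop_map_eq_zero_of_isAffine_of_isLimit _ _ h (.op i) x hx
  exact ⟨j.unop, leOfHom f.unop, hj⟩

/-- Closedness of the images of the transition maps makes the coordinate ring of the limit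
spectrally approximable. -/
theorem isSpectrallyApproximable_coordRing [IsAlgClosed k]
    (hD : ∀ i : I, IsAlgebraicGroup (D.obj (.op i))) (hc : IsLimit c) :
    IsSpectrallyApproximable k (CoordRing c.pt.X) := by
  have haff (i : Iᵒᵖ) : IsAffine (D.obj i).X.left := (hD i.unop).isAffine
  have hft (i : Iᵒᵖ) : LocallyOfFiniteType (D.obj i).X.hom := (hD i.unop).locallyOfFiniteType
  refine .of_directed (R := fun i : I ↦ CoordRing (D.obj (.op i)).X) (transitionMap D)
    (fun i ↦ CoordRing.map (c.π.app (.op i)).hom.hom) (fun i j l hij hjl x ↦ ?_)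
    (fun i j hij x ↦ ?_) (exists_coordRing_map_eq haff hc) (exists_transitionMap_eq_zero haff hc)
    fun i j hij ↦ CoordRing.isClosed_range_comap_map _ (isClosed_range_of_isMonHom _)
  · rw [transitionMap, transitionMap, transitionMap, ← CoordRing.map_comp,
      ← Grp.comp_hom_hom, ← D.map_comp]
    rfl
  · rw [transitionMap, ← CoordRing.map_comp, ← Grp.comp_hom_hom, c.w]

theorem rank_coordRing_le (hD : ∀ i : I, IsAlgebraicGroup (D.obj (.op i))) (hc : IsLimit c) :
    Module.rank k (CoordRing c.pt.X) ≤ max (Cardinal.mk I) Cardinal.aleph0 := by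
  have haff (i : Iᵒᵖ) : IsAffine (D.obj i).X.left := (hD i.unop).isAffine
  have hft (i : Iᵒᵖ) : LocallyOfFiniteType (D.obj i).X.hom := (hD i.unop).locallyOfFiniteType
  exact rank_le_max_of_surjective (fun i : I ↦ CoordRing.map (c.π.app (.op i)).hom.hom)
    (exists_coordRing_map_eq haff hc)

end Limit

/-! ### Trivializing a torsor -/

/-- A torsor `X` under `M` becomes isomorphic to `M` over any `T` with a point `T ⟶ X`. -/
theorem ModObj.exists_iso_of_isIso_leftSMul {C : Type*} [Category* C] [CartesianMonoidalCategory C]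
    {M X T : C} [MonObj M] [ModObj M X] (h : IsIso (ModObj.leftSMul M X)) (p : T ⟶ X) :
    ∃ e : T ⊗ M ≅ T ⊗ X, e.hom ≫ fst T X = fst T M := by
  rw [ModObj.isIso_leftSMul_iff] at h
  obtain ⟨m, hm, -⟩ := h (T ⊗ X) (fst T X ≫ p) (snd T X)
  refine ⟨⟨lift (fst T M) (snd T M • (fst T M ≫ p)), lift (fst T X) m, ?_, ?_⟩, by simp⟩
  · ext
    · simp
    · obtain ⟨m', -, hm'⟩ := h (T ⊗ M) (fst T M ≫ p) (snd T M • (fst T M ≫ p))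
      refine (hm' _ ?_).trans (hm' (snd T M) rfl).symm |>.trans (by simp)
      simp only [comp_lift, lift_fst, lift_snd]
      have := congr(lift (fst T M) (snd T M • (fst T M ≫ p)) ≫ $hm)
      simpa [ModObj.comp_smul] using this
  · ext
    · simp
    · simp [ModObj.comp_smul, hm]

section Torsor

variable {k : Type u} [Field k]

open scoped TensorProduct in
/-- Over a field `K` over which the torsor `P` has a point, the coordinate rings of `P` and of the
group become isomorphic. -/
theorem IsAffineTorsor.nonempty_algEquiv {G : GroupSchemeOver k} (hG : IsAffineGroupScheme G)
    {P : SchemeOver k} [ModObj G.X P] (hP : IsAffineTorsor G P) (K : Type u) [Field K] [Algebra k K]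
    (p : CoordRing P →ₐ[k] K) : Nonempty (K ⊗[k] CoordRing G.X ≃ₐ[K] K ⊗[k] CoordRing P) := by
  have : IsAffine G.X.left := hG
  have : IsAffine P.left := hP.isAffine
  -- Instance search does not find these instances for the ring `CommRingCat.of k`.
  let : (algSpec (.of k)).Braided := braidedAlgSpec
  have : (algSpec (.of k)).Full := algSpec.instFull
  have : (algSpec (.of k)).Faithful := algSpec.instFaithful
  let A : (CommAlgCat (CommRingCat.of k))ᵒᵖ := .op (.of _ (CoordRing G.X))
  let B : (CommAlgCat (CommRingCat.of k))ᵒᵖ := .op (.of _ (CoordRing P))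
  let T : (CommAlgCat (CommRingCat.of k))ᵒᵖ := .op (.of _ K)
  let p' : T ⟶ B := (CommAlgCat.ofHom p).op
  obtain ⟨e, he⟩ := ModObj.exists_iso_of_isIso_leftSMul (M := G.X) hP.isIso
    ((algSpec (.of k)).map p' ≫ (isoAlgSpec P).inv)
  let e₁ : (algSpec (.of k)).obj T ⊗ (algSpec (.of k)).obj A ≅
      (algSpec (.of k)).obj T ⊗ (algSpec (.of k)).obj B :=
    whiskerLeftIso _ (isoAlgSpec G.X).symm ≪≫ e ≪≫ whiskerLeftIso _ (isoAlgSpec P)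
  have he₁ : e₁.hom ≫ fst _ _ = fst _ _ := by
    have h := whiskerLeft_fst ((algSpec (.of k)).obj T) (isoAlgSpec P).hom
    have h' := whiskerLeft_fst ((algSpec (.of k)).obj T) (isoAlgSpec G.X).inv
    refine (Category.assoc _ _ _).trans (.trans ?_ h')
    exact congr(_ ≫ $((Category.assoc _ _ _).trans (congr(_ ≫ $h).trans he)))
  let e' : (algSpec (.of k)).obj (T ⊗ A) ≅ (algSpec (.of k)).obj (T ⊗ B) :=
    (Functor.Monoidal.μIso (algSpec (.of k)) T A).symm ≪≫ e₁ ≪≫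
      Functor.Monoidal.μIso (algSpec (.of k)) T B
  have he' : e'.hom ≫ (algSpec (.of k)).map (fst T B) = (algSpec (.of k)).map (fst T A) := by
    simp [e', he₁]
  let i : T ⊗ A ≅ T ⊗ B := (algSpec (.of k)).preimageIso e'
  have hi : i.hom ≫ fst T B = fst T A := (algSpec (.of k)).map_injective (by simpa [i] using he')
  let q := CommAlgCat.algEquivOfIso i.unop
  have hq (x : K) : q (x ⊗ₜ 1) = x ⊗ₜ 1 :=
    congr(($hi).unop.hom x)
  exact ⟨.symm <| .ofRingEquiv (f := q.toRingEquiv) hq⟩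

theorem nonempty_rationalPoints {P : SchemeOver k} [IsAffine P.left] (p : CoordRing P →ₐ[k] k) :
    Nonempty (RationalPoints P) := by
  let p' : (.op (CommAlgCat.of k k) : (CommAlgCat (CommRingCat.of k))ᵒᵖ) ⟶
    .op (.of k (CoordRing P)) := (CommAlgCat.ofHom p).op
  let s : Over.mk (𝟙 (Spec (.of k))) ⟶ (algSpec (.of k)).obj (.op (.of k k)) :=
    Over.homMk (𝟙 _) ((Category.id_comp _).trans (Spec.map_id _))
  exact ⟨s ≫ (algSpec (.of k)).map p' ≫ (isoAlgSpec P).inv⟩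

end Torsor

/-! ### Triviality of torsors under limits of algebraic groups -/

open scoped TensorProduct in
/-- The case of an index set in the universe of `k`, where limits of schemes are available. -/
theorem nonempty_rationalPoints_of_isLimit {k : Type u} [Field k] [IsAlgClosed k]
    {I : Type u} [PartialOrder I] [IsDirectedOrder I] [Nonempty I]
    {D : Iᵒᵖ ⥤ GroupSchemeOver k} (hD : ∀ i : I, IsAlgebraicGroup (D.obj (.op i)))
    {c : Cone D} (hG : IsAffineGroupScheme c.pt) (hc : IsLimit c)
    (hI : Countable I ∨ Cardinal.mk I < Cardinal.mk k)
    {P : SchemeOver k} [ModObj c.pt.X P] (hP : IsAffineTorsor c.pt P) :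
    Nonempty (RationalPoints P) := by
  have : IsAffine P.left := hP.isAffine
  have : Nonempty (⊤ : P.left.Opens) := hP.nonempty.map fun x ↦ ⟨x, trivial⟩
  have : Nontrivial (CoordRing P) := P.left.component_nontrivial ⊤
  obtain ⟨m, hm⟩ := Ideal.exists_maximal (CoordRing P)
  let : Field (CoordRing P ⧸ m) := Ideal.Quotient.field m
  obtain ⟨e⟩ := hP.nonempty_algEquiv hG (CoordRing P ⧸ m) (Ideal.Quotient.mkₐ k m)
  -- Dimension is unchanged by base change, so `P` and the group have equally large rings.
  have hr : Module.rank k (CoordRing P) = Module.rank k (CoordRing c.pt.X) := by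
    have h := e.toLinearEquiv.rank_eq
    rw [Module.rank_baseChange, Module.rank_baseChange] at h
    simpa using h.symm
  have hr' := rank_coordRing_le hD hc
  by_cases h : Countable I
  · have hs := ((isSpectrallyApproximable_coordRing hD hc).baseChange
      (CoordRing P ⧸ m)).of_algEquiv e
    obtain ⟨p⟩ := hs.nonempty_algHom (hr.trans_le (hr'.trans (by simp)))
    exact nonempty_rationalPoints p
  · have hI' := hI.resolve_left h
    rw [← Cardinal.mk_le_aleph0_iff, not_le] at h
    rw [max_eq_left h.le] at hr'
    obtain ⟨p⟩ := nonempty_algHom_of_rank_lt ((hr.trans_le hr').trans_lt hI')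
    exact nonempty_rationalPoints p

theorem theoremt2 {k : Type u} [Field k] [IsAlgClosed k]
    {I : Type w} [PartialOrder I] [IsDirectedOrder I] [Nonempty I]
    (D : Iᵒᵖ ⥤ GroupSchemeOver k) (hD : ∀ i : I, IsAlgebraicGroup (D.obj (Opposite.op i)))
    (G : GroupSchemeOver k) (hG : IsAffineGroupScheme G)
    (π : (Functor.const Iᵒᵖ).obj G ⟶ D) (hlim : IsLimit (Cone.mk G π))
    (hI : Countable I ∨ Cardinal.lift.{u} (Cardinal.mk I) < Cardinal.lift.{w} (Cardinal.mk k))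
    (P : SchemeOver k) [ModObj G.X P] (hP : IsAffineTorsor G P) :
    Nonempty (RationalPoints P) := by
  have : Small.{u} I := by
    rcases hI with h | h
    · exact Countable.toSmall I
    · obtain ⟨f⟩ := Cardinal.lift_mk_le'.mp h.le
      exact small_of_injective f.injective
  let S := Shrink.{u} I
  let : PartialOrder S := .lift (equivShrink I).symm (equivShrink I).symm.injective
  let e : S ≃o I := ⟨(equivShrink I).symm, Iff.rfl⟩
  have : IsDirectedOrder S := ⟨fun a b ↦ by
    obtain ⟨c, ha, hb⟩ := exists_ge_ge (e a) (e b)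
    exact ⟨e.symm c, e.le_symm_apply.mpr ha, e.le_symm_apply.mpr hb⟩⟩
  have : Nonempty S := e.toEquiv.nonempty
  have hS : Countable S ∨ Cardinal.mk S < Cardinal.mk k := by
    rcases hI with h | h
    · exact .inl e.injective.countable
    · refine .inr (Cardinal.lift_lt.{u, w}.mp ?_)
      exact (Cardinal.lift_mk_eq'.mpr ⟨e.toEquiv⟩).trans_lt h
  let c := (Cone.mk G π).whisker e.equivalence.op.functor
  let : ModObj c.pt.X P := ‹ModObj G.X P›
  exact nonempty_rationalPoints_of_isLimit (c := c)
    (fun i ↦ hD (e i)) hG (hlim.whiskerEquivalence e.equivalence.op) hS hP
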